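/- Let $\mathbb F\in\{\mathbb R,\mathbb C\}$. For positive integers $n_1,\dots,n_d$ write $\mathbf n=(n_1,\dots,n_d)$ and $\mathbb F^{\mathbf n}=\bigotimes_{i=1}^d\mathbb F^{n_i}$, with the standard inner product $\langle\mathcal T,\mathcal Y\rangle=\sum_{k_1,\dots,k_d} t_{k_1,\dots,k_d}\overline{y_{k_1,\dots,k_d}}$ and the Hilbert–Schmidt norm $\|\mathcal T\|=\sqrt{\langle\mathcal T,\mathcal T\rangle}$. The spectral norm of $\mathcal T\in\mathbb F^{\mathbf n}$ over $\mathbb F$ is $$\|\mathcal T\|_{\infty,\mathbb F}=\max\{|\langle\mathcal T,\mathbf x_1\otimes\cdots\otimes\mathbf x_d\rangle| : \mathbf x_i\in\mathbb F^{n_i},\ \|\mathbf x_i\|=1,\ i=1,\dots,d\},$$ and $$\beta(\mathbf n,\mathbb F)=\min\{\|\mathcal T\|_{\infty,\mathbb F} : \mathcal T\in\mathbb F^{\mathbf n},\ \|\mathcal T\|=1\}.$$ Let $n^{\times d}=(n,\dots,n)$ ($d$ entries). Then the following hold. 1. For all integers $n\ge 1$ and $d\ge 2$, $\displaystyle \beta(n^{\times(d+1)},\mathbb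 F)\ge \frac{1}{\sqrt n}\,\beta(n^{\times d},\mathbb F)$. 2. For all integers $n\ge 1$ and $d\ge 2$, $\displaystyle \beta(n^{\times d},\mathbb R)\ge n^{\frac{1-d}{2}}$. 3. For all integers $d\ge 3$, $\displaystyle \beta(2^{\times d},\mathbb C)\ge \frac23\cdot 2^{-\frac{d-3}{2}}$. -/

import Mathlib

/-- The space `𝕜^𝐧 = ⨂ᵢ 𝕜^{nᵢ}` of tensors of format `𝐧 = (n₁, …, n_d)`, given by their entries
`t_{k₁,…,k_d}`. The inner product is the standard one and the norm is the Hilbert-Schmidt norm. -/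
abbrev TensorSpace (𝕜 : Type*) [RCLike 𝕜] {d : ℕ} (n : Fin d → ℕ) : Type _ :=
  EuclideanSpace 𝕜 ((i : Fin d) → Fin (n i))

namespace TensorSpace

/-- The simple tensor `x₁ ⊗ ⋯ ⊗ x_d`. -/
def simpleTensor {𝕜 : Type*} [RCLike 𝕜] {d : ℕ} {n : Fin d → ℕ}
    (x : (i : Fin d) → EuclideanSpace 𝕜 (Fin (n i))) : TensorSpace 𝕜 n :=
  WithLp.toLp 2 fun k => ∏ i, x i (k i)

/-- The set of simple tensors `x₁ ⊗ ⋯ ⊗ x_d` with all `xᵢ` of Euclidean norm one. -/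
def unitSimple (𝕜 : Type*) [RCLike 𝕜] {d : ℕ} (n : Fin d → ℕ) : Set (TensorSpace 𝕜 n) :=
  {X | ∃ x : (i : Fin d) → EuclideanSpace 𝕜 (Fin (n i)), (∀ i, ‖x i‖ = 1) ∧ X = simpleTensor x}

/-- The spectral norm over `𝕜`: the maximum of `|⟨T, X⟩|` over unit simple tensors `X`
(the maximum exists, see `isGreatest_specNorm`). Mathlib's inner product is conjugate-linear in
its first argument, so that `⟨T, X⟩ = ∑ₖ tₖ · conj xₖ` is `inner 𝕜 X T`. -/
noncomputable def specNorm {𝕜 : Type*} [RCLike 𝕜] {d : ℕ} {n : Fin d → ℕ}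
    (T : TensorSpace 𝕜 n) : ℝ :=
  sSup ((fun X : TensorSpace 𝕜 n => ‖inner 𝕜 X T‖) '' unitSimple 𝕜 n)

/-- `β(𝐧, 𝕜)`: the minimum of the spectral norm over tensors of Hilbert-Schmidt norm one
(the minimum exists, see `isLeast_beta`). -/
noncomputable def beta (𝕜 : Type*) [RCLike 𝕜] {d : ℕ} (n : Fin d → ℕ) : ℝ :=
  sInf (specNorm '' {T : TensorSpace 𝕜 n | ‖T‖ = 1})

theorem isCompact_unitSimple (𝕜 : Type*) [RCLike 𝕜] {d : ℕ} (n : Fin d → ℕ) :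
    IsCompact (unitSimple 𝕜 n) := by
  have h1 : IsCompact (Set.univ.pi fun i : Fin d =>
      Metric.sphere (0 : EuclideanSpace 𝕜 (Fin (n i))) 1) :=
    isCompact_univ_pi fun i => isCompact_sphere _ _
  have h2 : Continuous (simpleTensor : ((i : Fin d) → EuclideanSpace 𝕜 (Fin (n i))) → TensorSpace 𝕜 n) := by
    unfold simpleTensor
    fun_prop
  convert h1.image h2 using 1
  ext X
  simp [unitSimple, Set.mem_pi, eq_comm]

theorem exists_norm_eq_one (𝕜 : Type*) [RCLike 𝕜] {ι : Type*} [Fintype ι] [Nonempty ι] :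
    ∃ x : EuclideanSpace 𝕜 ι, ‖x‖ = 1 := by
  classical
  exact ⟨EuclideanSpace.single (Classical.arbitrary ι) 1, by simp⟩

theorem unitSimple_nonempty (𝕜 : Type*) [RCLike 𝕜] {d : ℕ} {n : Fin d → ℕ} (hn : ∀ i, 0 < n i) :
    (unitSimple 𝕜 n).Nonempty := by
  have h : ∀ i, ∃ x : EuclideanSpace 𝕜 (Fin (n i)), ‖x‖ = 1 := fun i =>
    haveI : Nonempty (Fin (n i)) := ⟨⟨0, hn i⟩⟩
    exists_norm_eq_one 𝕜
  choose x hx using h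
  exact ⟨simpleTensor x, x, hx, rfl⟩

/-- The spectral norm is a maximum. -/
theorem isGreatest_specNorm {𝕜 : Type*} [RCLike 𝕜] {d : ℕ} {n : Fin d → ℕ} (hn : ∀ i, 0 < n i)
    (T : TensorSpace 𝕜 n) :
    IsGreatest ((fun X : TensorSpace 𝕜 n => ‖inner 𝕜 X T‖) '' unitSimple 𝕜 n) (specNorm T) :=
  ((isCompact_unitSimple 𝕜 n).image (by fun_prop)).isGreatest_sSup
    ((unitSimple_nonempty 𝕜 hn).image _)

/-- `β(𝐧, 𝕜)` is a minimum. -/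
theorem isLeast_beta (𝕜 : Type*) [RCLike 𝕜] {d : ℕ} {n : Fin d → ℕ} (hn : ∀ i, 0 < n i) :
    IsLeast (specNorm '' {T : TensorSpace 𝕜 n | ‖T‖ = 1}) (beta 𝕜 n) := by
  have hc : Continuous (specNorm : TensorSpace 𝕜 n → ℝ) := by
    refine (isCompact_unitSimple 𝕜 n).continuous_sSup
      (f := fun (T X : TensorSpace 𝕜 n) => ‖inner 𝕜 X T‖) ?_
    change Continuous fun p : TensorSpace 𝕜 n × TensorSpace 𝕜 n => ‖inner 𝕜 p.2 p.1‖
    fun_prop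
  have hs : IsCompact {T : TensorSpace 𝕜 n | ‖T‖ = 1} := by
    have h : {T : TensorSpace 𝕜 n | ‖T‖ = 1} = Metric.sphere 0 1 :=
      Set.ext fun T => by rw [Set.mem_ofPred_eq, mem_sphere_zero_iff_norm]
    rw [h]
    exact isCompact_sphere _ _
  have : Nonempty ((i : Fin d) → Fin (n i)) := ⟨fun i => ⟨0, hn i⟩⟩
  exact (hs.image hc).isLeast_sInf (Set.Nonempty.image _ (exists_norm_eq_one 𝕜))

end TensorSpace

/-! Slicing a unit tensor along one mode gives `n` tensors whose squared norms sum to one, so some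
slice has norm at least `1 / √n`, and a basis vector in that mode selects it. Iterating this reduces
the other two bounds to base cases: one mode, where every tensor is simple, and three qubits, where
`2 / 3` is needed.

For three qubits, view the tensor as a pencil `M(v)` of `2 × 2` matrices with squared spectral norm
`s`. For a unit vector `v`, both squared singular values of `M(v)` are at most `s`, which bounds
`|det M(v)|` from below in terms of the Frobenius norm (`matrix_two_bounds`). But `det M(v)` is a
quadratic form in `v`, diagonal in some orthonormal basis (`exists_orthonormal_diag`), and a phase
can make its two diagonal terms cancel (`exists_phase_sq_opposite`). For `s < 4 / 9` the
cancellation violates the lower bound (`pencil_constraints_false`). -/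

/-! ### Real inequalities -/

/-- The numerical core of the bound on pencils of `2 × 2` matrices: below the value `4 / 9` the
constraints on the norms and the determinants of the members of a pencil are contradictory. -/
theorem pencil_constraints_false_of_half_le {s u a b : ℝ} (hs : s < 4 / 9)
    (hu : 1 / 2 ≤ u) (hus : u ≤ 2 * s) (ha : 0 ≤ a) (hau : a ≤ u / 2) (hb : 0 ≤ b)
    (h : ∀ t : ℝ, 0 ≤ t → t ≤ 1 →
      s * (u * t + (1 - u) * (1 - t) - s) ≤ (a * t - b * (1 - t)) ^ 2) : False := by
  have hu0 : 0 < u := by linarith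
  have hspos : 0 < s := by linarith
  -- After division by `u - 1 < 0` this is `s * (3 * u - 1) < u ^ 2`; the threshold `4 / 9` enters
  -- through `u ^ 2 - 4 / 9 * (3 * u - 1) = (u - 2 / 3) ^ 2`.
  have hdisc : u ^ 2 * (s - 1 + u) < s * (2 * u - 1) ^ 2 := by
    have h1 : s * (3 * u - 1) < u ^ 2 := by nlinarith [sq_nonneg (u - 2 / 3)]
    nlinarith
  -- The minimizer of `(u * t / 2) ^ 2 - s * (u * t + (1 - u) * (1 - t) - s)`; `hdisc` makes the
  -- minimum negative.
  obtain ⟨t, ht⟩ : ∃ t, t = 2 * s * (2 * u - 1) / u ^ 2 := ⟨_, rfl⟩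
  have htu : u ^ 2 * t = 2 * s * (2 * u - 1) := by rw [ht]; field_simp
  have ht0 : 0 ≤ t := by rw [ht]; apply div_nonneg <;> nlinarith
  have ht1 : t ≤ 1 := by
    rw [ht, div_le_one (by positivity)]
    nlinarith [sq_nonneg (u - 8 / 9)]
  have hlin : s < u * t + (1 - u) * (1 - t) := by
    have : u ^ 2 * (s - (1 - u)) < u ^ 2 * ((2 * u - 1) * t) := by nlinarith
    have := lt_of_mul_lt_mul_left this (by positivity)
    linarith
  rcases le_or_gt 0 (a * t - b * (1 - t)) with hL | hL
  · have hL2 : a * t - b * (1 - t) ≤ u * t / 2 := by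
      have := mul_nonneg hb (sub_nonneg.2 ht1)
      have := mul_le_mul_of_nonneg_right hau ht0
      linarith
    have h1 := (h t ht0 ht1).trans (pow_le_pow_left₀ hL hL2 2)
    have h2 : u ^ 2 * (s * (u * t + (1 - u) * (1 - t) - s)) ≤ u ^ 2 * (u * t / 2) ^ 2 :=
      mul_le_mul_of_nonneg_left h1 (by positivity)
    have h3 : u ^ 2 * (u * t / 2) ^ 2 = (s * (2 * u - 1)) ^ 2 := by
      linear_combination (u ^ 2 * t + 2 * s * (2 * u - 1)) / 4 * htu
    have h4 : u ^ 2 * (s * (u * t + (1 - u) * (1 - t) - s)) =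
        s * (2 * s * (2 * u - 1) ^ 2 - u ^ 2 * (s - 1 + u)) := by
      linear_combination s * (2 * u - 1) * htu
    nlinarith
  -- The right side of `h` vanishes at some `r ≥ t`, while the left side is nondecreasing as `1 / 2
  -- ≤ u`, hence still positive there.
  · have hab : 0 < a + b := by
      by_contra! hab
      obtain rfl : a = 0 := by linarith
      obtain rfl : b = 0 := by linarith
      simp at hL
    obtain ⟨r, hr⟩ : ∃ r, r = b / (a + b) := ⟨_, rfl⟩
    have hr0 : 0 ≤ r := by rw [hr]; positivity
    have hr1 : r ≤ 1 := by rw [hr, div_le_one hab]; linarith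
    have htr : t ≤ r := by rw [hr, le_div_iff₀ hab]; linarith
    have hroot : a * r - b * (1 - r) = 0 := by rw [hr]; field_simp; ring
    have h1 := h r hr0 hr1
    rw [hroot] at h1
    nlinarith [mul_nonneg (sub_nonneg.2 htr) (by linarith : (0 : ℝ) ≤ 2 * u - 1)]

/-- The constraints are symmetric under exchanging the two basis members of the pencil, so `1 / 2 ≤
u` may be assumed. -/
theorem pencil_constraints_false {s u a b : ℝ} (hs : s < 4 / 9)
    (hus : u ≤ 2 * s) (hus' : 1 - u ≤ 2 * s) (ha : 0 ≤ a) (hau : a ≤ u / 2) (hb : 0 ≤ b)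
    (hbu : b ≤ (1 - u) / 2)
    (h : ∀ t : ℝ, 0 ≤ t → t ≤ 1 →
      s * (u * t + (1 - u) * (1 - t) - s) ≤ (a * t - b * (1 - t)) ^ 2) : False := by
  rcases le_total (1 / 2) u with hu | hu
  · exact pencil_constraints_false_of_half_le hs hu hus ha hau hb h
  · refine pencil_constraints_false_of_half_le (u := 1 - u) (a := b) (b := a) hs
      (by linarith) hus' hb hbu ha fun t ht0 ht1 => ?_
    have := h (1 - t) (by linarith) (by linarith)
    linarith

/-! ### Matrices of size two -/

/-- The sum of the squared absolute values of the entries of a `2 × 2` matrix dominates twice the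
absolute value of its determinant. -/
theorem two_mul_norm_det_le (p q r w : ℂ) :
    2 * ‖p * w - q * r‖ ≤ ‖p‖ ^ 2 + ‖q‖ ^ 2 + ‖r‖ ^ 2 + ‖w‖ ^ 2 := by
  have := norm_sub_le (p * w) (q * r)
  rw [norm_mul, norm_mul] at this
  nlinarith [sq_nonneg (‖p‖ - ‖w‖), sq_nonneg (‖q‖ - ‖r‖)]

/-- A `2 × 2` matrix whose squared operator norm is at most `s` has both roots of the
characteristic polynomial of `MᴴM` bounded by `s`. -/
theorem matrix_two_bounds {s : ℝ} {p q r w : ℂ}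
    (h : ∀ x₀ x₁ y₀ y₁ : ℂ, ‖p * x₀ * y₀ + q * x₀ * y₁ + r * x₁ * y₀ + w * x₁ * y₁‖ ^ 2 ≤
      s * (‖x₀‖ ^ 2 + ‖x₁‖ ^ 2) * (‖y₀‖ ^ 2 + ‖y₁‖ ^ 2)) :
    ‖p‖ ^ 2 + ‖q‖ ^ 2 + ‖r‖ ^ 2 + ‖w‖ ^ 2 ≤ 2 * s ∧
      s * (‖p‖ ^ 2 + ‖q‖ ^ 2 + ‖r‖ ^ 2 + ‖w‖ ^ 2) - s ^ 2 ≤ ‖p * w - q * r‖ ^ 2 := by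
  have key (y₀ y₁ : ℂ) : ‖p * y₀ + q * y₁‖ ^ 2 + ‖r * y₀ + w * y₁‖ ^ 2 ≤
      s * (‖y₀‖ ^ 2 + ‖y₁‖ ^ 2) := by
    -- Pairing `My` with its own conjugate turns the bilinear bound into an operator norm bound.
    have h1 := h (starRingEnd ℂ (p * y₀ + q * y₁)) (starRingEnd ℂ (r * y₀ + w * y₁)) y₀ y₁
    have h2 : p * starRingEnd ℂ (p * y₀ + q * y₁) * y₀ + q * starRingEnd ℂ (p * y₀ + q * y₁) * y₁ +
        r * starRingEnd ℂ (r * y₀ + w * y₁) * y₀ + w * starRingEnd ℂ (r * y₀ + w * y₁) * y₁ =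
        ((‖p * y₀ + q * y₁‖ ^ 2 + ‖r * y₀ + w * y₁‖ ^ 2 : ℝ) : ℂ) := by
      push_cast
      rw [← Complex.mul_conj', ← Complex.mul_conj']
      ring
    rw [h2, Complex.norm_real, Real.norm_eq_abs, sq_abs, RCLike.norm_conj, RCLike.norm_conj] at h1
    have h0 : 0 ≤ ‖p * y₀ + q * y₁‖ ^ 2 + ‖r * y₀ + w * y₁‖ ^ 2 := by positivity
    rcases h0.eq_or_lt with h0 | h0
    · rw [← h0]
      have hs : 0 ≤ s := by
        have := h 1 0 1 0
        simp only [norm_one, norm_zero] at this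
        nlinarith [sq_nonneg ‖p * 1 * 1 + q * 1 * 0 + r * 0 * 1 + w * 0 * 0‖]
      positivity
    · nlinarith
  have k1 : ‖p‖ ^ 2 + ‖r‖ ^ 2 ≤ s := by simpa using key 1 0
  have k2 : ‖q‖ ^ 2 + ‖w‖ ^ 2 ≤ s := by simpa using key 0 1
  refine ⟨by linarith, ?_⟩
  set g : ℂ := starRingEnd ℂ p * q + starRingEnd ℂ r * w with hg
  have hdet : ‖p * w - q * r‖ ^ 2 =
      (‖p‖ ^ 2 + ‖r‖ ^ 2) * (‖q‖ ^ 2 + ‖w‖ ^ 2) - ‖g‖ ^ 2 := by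
    simp only [hg, Complex.sq_norm, Complex.normSq_apply, Complex.add_re, Complex.add_im,
      Complex.sub_re, Complex.sub_im, Complex.mul_re, Complex.mul_im, Complex.conj_re,
      Complex.conj_im]
    ring
  -- Positivity of `s - MᴴM` on the vectors `(k * g, 1)`; the discriminant in `k` yields `det (s -
  -- MᴴM) ≥ 0`.
  have hquad (k : ℝ) : 0 ≤ ((s - (‖p‖ ^ 2 + ‖r‖ ^ 2)) * ‖g‖ ^ 2) * (k * k) +
      (-2 * ‖g‖ ^ 2) * k + (s - (‖q‖ ^ 2 + ‖w‖ ^ 2)) := by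
    have h1 := key (k * g) 1
    have h2 : ‖p * (k * g) + q * 1‖ ^ 2 + ‖r * (k * g) + w * 1‖ ^ 2 =
        (‖p‖ ^ 2 + ‖r‖ ^ 2) * ‖g‖ ^ 2 * (k * k) + 2 * ‖g‖ ^ 2 * k + (‖q‖ ^ 2 + ‖w‖ ^ 2) := by
      simp only [hg, Complex.sq_norm, Complex.normSq_apply, Complex.add_re, Complex.add_im,
        Complex.mul_re, Complex.mul_im, Complex.conj_re, mul_one, Complex.ofReal_re,
        Complex.ofReal_im, Complex.conj_im]
      ring
    rw [h2, norm_mul, Complex.norm_real, Real.norm_eq_abs, mul_pow, sq_abs, norm_one] at h1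
    linarith
  have hd := discrim_le_zero hquad
  rw [discrim] at hd
  have hle : ‖g‖ ^ 2 ≤ (s - (‖p‖ ^ 2 + ‖r‖ ^ 2)) * (s - (‖q‖ ^ 2 + ‖w‖ ^ 2)) := by
    rcases (sq_nonneg ‖g‖).eq_or_lt with h0 | h0
    · rw [← h0]
      exact mul_nonneg (by linarith) (by linarith)
    · refine le_of_mul_le_mul_left ?_ h0
      nlinarith
  rw [hdet]
  linarith

/-! ### Diagonalization and phases -/

/-- A binary complex quadratic form `a v₀² + 2 b v₀ v₁ + c v₁²` is diagonal in some orthonormal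
basis `(z₀, z₁)`, `(-z̄₁, z̄₀)`. -/
theorem exists_orthonormal_diag (a b c : ℂ) : ∃ z₀ z₁ : ℂ, ‖z₀‖ ^ 2 + ‖z₁‖ ^ 2 = 1 ∧
    a * z₀ * -starRingEnd ℂ z₁ + b * (z₀ * starRingEnd ℂ z₀ - z₁ * starRingEnd ℂ z₁) +
      c * z₁ * starRingEnd ℂ z₀ = 0 := by
  -- Here `ζ = z₁ / z₀`. Writing `ζ = r * e` with a suitable phase `e` makes the equation a real
  -- quadratic in `r`, times `b`.
  suffices H : ∃ ζ : ℂ, -a * starRingEnd ℂ ζ + b * (1 - ζ * starRingEnd ℂ ζ) + c * ζ = 0 by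
    obtain ⟨ζ, hζ⟩ := H
    have hN : 0 < 1 + ‖ζ‖ ^ 2 := by positivity
    obtain ⟨m, hm⟩ : ∃ m : ℝ, m = (√(1 + ‖ζ‖ ^ 2))⁻¹ := ⟨_, rfl⟩
    have hm2 : m ^ 2 * (1 + ‖ζ‖ ^ 2) = 1 := by
      rw [hm, inv_pow, Real.sq_sqrt hN.le, inv_mul_cancel₀ hN.ne']
    refine ⟨m, m * ζ, ?_, ?_⟩
    · rw [norm_mul, Complex.norm_real, Real.norm_eq_abs, mul_pow, sq_abs]
      linarith
    · simp only [map_mul, Complex.conj_ofReal]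
      linear_combination (m : ℂ) ^ 2 * hζ
  by_cases hb : b = 0
  · exact ⟨0, by simp [hb]⟩
  obtain ⟨e, he, hem⟩ : ∃ e : ℂ, ‖e‖ = 1 ∧
      ((c * starRingEnd ℂ b + starRingEnd ℂ a * b) * e).im = 0 := by
    obtain ⟨m, hm⟩ : ∃ m : ℂ, m = c * starRingEnd ℂ b + starRingEnd ℂ a * b := ⟨_, rfl⟩
    rw [← hm]
    rcases eq_or_ne m 0 with h0 | h0
    · exact ⟨1, by simp, by simp [h0]⟩
    · refine ⟨starRingEnd ℂ m / ‖m‖, by simp [h0], ?_⟩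
      rw [← mul_div_assoc, Complex.mul_conj, ← Complex.ofReal_div, Complex.ofReal_im]
  have hee : e * starRingEnd ℂ e = 1 := by rw [Complex.mul_conj', he]; simp
  obtain ⟨k, hk⟩ : ∃ k : ℝ, c * e - a * starRingEnd ℂ e = k * b := by
    have him : ((c * e - a * starRingEnd ℂ e) * starRingEnd ℂ b).im = 0 := by
      rw [← hem]
      simp only [Complex.add_re, Complex.add_im, Complex.sub_re, Complex.sub_im, Complex.mul_re,
        Complex.mul_im, Complex.conj_re, Complex.conj_im]
      ring
    refine ⟨((c * e - a * starRingEnd ℂ e) * starRingEnd ℂ b).re / ‖b‖ ^ 2, ?_⟩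
    have hb' : (‖b‖ : ℂ) ^ 2 ≠ 0 := by simpa using hb
    have h1 : (((c * e - a * starRingEnd ℂ e) * starRingEnd ℂ b).re : ℂ) =
        (c * e - a * starRingEnd ℂ e) * starRingEnd ℂ b :=
      Complex.ext (by simp) (by rw [him, Complex.ofReal_im])
    push_cast [h1]
    rw [div_mul_eq_mul_div, eq_div_iff hb', ← Complex.mul_conj']
    ring
  obtain ⟨r, hr⟩ : ∃ r : ℝ, 1 - r ^ 2 + r * k = 0 := by
    refine ⟨(k + √(k ^ 2 + 4)) / 2, ?_⟩
    have := Real.sq_sqrt (by positivity : 0 ≤ k ^ 2 + 4)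
    linear_combination -this / 4
  have hr' : (1 : ℂ) - r ^ 2 + r * k = 0 := by exact_mod_cast hr
  refine ⟨r * e, ?_⟩
  simp only [map_mul, Complex.conj_ofReal]
  linear_combination (r : ℂ) * hk - b * r ^ 2 * hee + b * hr'

/-- Any two complex numbers can be put in opposite directions by multiplying the second with
the square of a phase. -/
theorem exists_phase_sq_opposite (α β : ℂ) : ∃ c : ℂ, ‖c‖ = 1 ∧ ∀ t r : ℝ,
    ‖t * α + r * (c ^ 2 * β)‖ ^ 2 = (‖α‖ * t - ‖β‖ * r) ^ 2 := by
  obtain ⟨θ, hθ⟩ : ∃ θ : ℝ, α = ‖α‖ * Complex.exp (θ * Complex.I) :=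
    ⟨α.arg, (Complex.norm_mul_exp_arg_mul_I α).symm⟩
  obtain ⟨φ, hφ⟩ : ∃ φ : ℝ, β = ‖β‖ * Complex.exp (φ * Complex.I) :=
    ⟨β.arg, (Complex.norm_mul_exp_arg_mul_I β).symm⟩
  obtain ⟨c, hc⟩ : ∃ c : ℂ, c = Complex.exp (((θ - φ + Real.pi) / 2 : ℝ) * Complex.I) := ⟨_, rfl⟩
  have h1 : c ^ 2 * Complex.exp (φ * Complex.I) = -Complex.exp (θ * Complex.I) := by
    rw [hc, ← Complex.exp_nat_mul, ← Complex.exp_add,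
      show ((2 : ℕ) : ℂ) * (((θ - φ + Real.pi) / 2 : ℝ) * Complex.I) + φ * Complex.I =
        θ * Complex.I + Real.pi * Complex.I by push_cast; ring,
      Complex.exp_add, Complex.exp_pi_mul_I]
    ring
  refine ⟨c, by rw [hc, Complex.norm_exp_ofReal_mul_I], fun t r => ?_⟩
  have h2 : t * α + r * (c ^ 2 * β) =
      ((‖α‖ * t - ‖β‖ * r : ℝ) : ℂ) * Complex.exp (θ * Complex.I) := by
    push_cast
    linear_combination (t : ℂ) * hθ + r * c ^ 2 * hφ + r * ‖β‖ * h1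
  rw [h2, norm_mul, Complex.norm_exp_ofReal_mul_I, mul_one, Complex.norm_real, Real.norm_eq_abs,
    sq_abs]

/-! ### Pencils of matrices -/

/-- A trilinear form on `ℂ²` with coefficients of square sum one has squared spectral norm at
least `4 / 9`. -/
theorem four_ninths_le_of_trilinear_bound {s : ℝ} {a b : Fin 2 → Fin 2 → ℂ}
    (hT : (‖a 0 0‖ ^ 2 + ‖a 0 1‖ ^ 2 + ‖a 1 0‖ ^ 2 + ‖a 1 1‖ ^ 2) +
      (‖b 0 0‖ ^ 2 + ‖b 0 1‖ ^ 2 + ‖b 1 0‖ ^ 2 + ‖b 1 1‖ ^ 2) = 1)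
    (h : ∀ v₀ v₁ x₀ x₁ y₀ y₁ : ℂ, ‖(a 0 0 * v₀ + b 0 0 * v₁) * x₀ * y₀ +
      (a 0 1 * v₀ + b 0 1 * v₁) * x₀ * y₁ + (a 1 0 * v₀ + b 1 0 * v₁) * x₁ * y₀ +
      (a 1 1 * v₀ + b 1 1 * v₁) * x₁ * y₁‖ ^ 2 ≤
      s * (‖v₀‖ ^ 2 + ‖v₁‖ ^ 2) * (‖x₀‖ ^ 2 + ‖x₁‖ ^ 2) * (‖y₀‖ ^ 2 + ‖y₁‖ ^ 2)) :
    4 / 9 ≤ s := by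
  by_contra! hs
  obtain ⟨M, hM⟩ : ∃ M : Fin 2 → Fin 2 → ℂ → ℂ → ℂ,
    M = fun i j v₀ v₁ => a i j * v₀ + b i j * v₁ := ⟨_, rfl⟩
  obtain ⟨F, hF⟩ : ∃ F : ℂ → ℂ → ℝ, F = fun v₀ v₁ =>
    ‖M 0 0 v₀ v₁‖ ^ 2 + ‖M 0 1 v₀ v₁‖ ^ 2 + ‖M 1 0 v₀ v₁‖ ^ 2 + ‖M 1 1 v₀ v₁‖ ^ 2 := ⟨_, rfl⟩
  obtain ⟨D, hD⟩ : ∃ D : ℂ → ℂ → ℂ, D = fun v₀ v₁ =>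
    M 0 0 v₀ v₁ * M 1 1 v₀ v₁ - M 0 1 v₀ v₁ * M 1 0 v₀ v₁ := ⟨_, rfl⟩
  have hmem (v₀ v₁ : ℂ) (hv : ‖v₀‖ ^ 2 + ‖v₁‖ ^ 2 = 1) :
      F v₀ v₁ ≤ 2 * s ∧ s * F v₀ v₁ - s ^ 2 ≤ ‖D v₀ v₁‖ ^ 2 := by
    rw [hF, hD]
    refine matrix_two_bounds fun x₀ x₁ y₀ y₁ => ?_
    have := h v₀ v₁ x₀ x₁ y₀ y₁
    rw [hv, mul_one] at this
    rw [hM]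
    exact this
  have hDF (v₀ v₁ : ℂ) : ‖D v₀ v₁‖ ≤ F v₀ v₁ / 2 := by
    have := two_mul_norm_det_le (M 0 0 v₀ v₁) (M 0 1 v₀ v₁) (M 1 0 v₀ v₁) (M 1 1 v₀ v₁)
    rw [hF, hD]
    dsimp only
    linarith
  obtain ⟨z₀, z₁, hz, hdiag⟩ := exists_orthonormal_diag (a 0 0 * a 1 1 - a 0 1 * a 1 0)
    ((a 0 0 * b 1 1 + b 0 0 * a 1 1 - a 0 1 * b 1 0 - b 0 1 * a 1 0) / 2)
    (b 0 0 * b 1 1 - b 0 1 * b 1 0)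
  obtain ⟨w₀, hw₀⟩ : ∃ w₀, w₀ = -starRingEnd ℂ z₁ := ⟨_, rfl⟩
  obtain ⟨w₁, hw₁⟩ : ∃ w₁, w₁ = starRingEnd ℂ z₀ := ⟨_, rfl⟩
  have hw : ‖w₀‖ ^ 2 + ‖w₁‖ ^ 2 = 1 := by
    rw [hw₀, hw₁, norm_neg, RCLike.norm_conj, RCLike.norm_conj]; linarith
  have hnorm (p q x y : ℂ) : ‖p * (x * z₀ + y * w₀) + q * (x * z₁ + y * w₁)‖ ^ 2 +
      ‖p * (x * z₀ + -y * w₀) + q * (x * z₁ + -y * w₁)‖ ^ 2 =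
      2 * (‖x‖ ^ 2 * ‖p * z₀ + q * z₁‖ ^ 2 + ‖y‖ ^ 2 * ‖p * w₀ + q * w₁‖ ^ 2) := by
    have := parallelogram_law_with_norm ℝ (x * (p * z₀ + q * z₁)) (y * (p * w₀ + q * w₁))
    rw [norm_mul, norm_mul] at this
    rw [show p * (x * z₀ + y * w₀) + q * (x * z₁ + y * w₁) =
        x * (p * z₀ + q * z₁) + y * (p * w₀ + q * w₁) by ring,
      show p * (x * z₀ + -y * w₀) + q * (x * z₁ + -y * w₁) =
        x * (p * z₀ + q * z₁) - y * (p * w₀ + q * w₁) by ring]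
    linarith
  have hunit (x y : ℂ) : ‖x * z₀ + y * w₀‖ ^ 2 + ‖x * z₁ + y * w₁‖ ^ 2 = ‖x‖ ^ 2 + ‖y‖ ^ 2 := by
    rw [← mul_one (‖x‖ ^ 2 + ‖y‖ ^ 2), ← hz, hw₀, hw₁]
    simp only [Complex.sq_norm, Complex.normSq_apply, Complex.add_re, Complex.add_im,
        Complex.mul_re, Complex.mul_im, Complex.conj_re, Complex.conj_im, Complex.neg_re,
        Complex.neg_im]
    ring
  have hFsum : F z₀ z₁ + F w₀ w₁ = 1 := by
    have hpq (p q : ℂ) : ‖p * z₀ + q * z₁‖ ^ 2 + ‖p * w₀ + q * w₁‖ ^ 2 = ‖p‖ ^ 2 + ‖q‖ ^ 2 := by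
      rw [← mul_one (‖p‖ ^ 2 + ‖q‖ ^ 2), ← hz, hw₀, hw₁]
      simp only [Complex.sq_norm, Complex.normSq_apply, Complex.add_re, Complex.add_im,
        Complex.mul_re, Complex.mul_im, Complex.conj_re, Complex.conj_im, Complex.neg_re,
        Complex.neg_im]
      ring
    rw [hF, hM]
    dsimp only
    linarith [hpq (a 0 0) (b 0 0), hpq (a 0 1) (b 0 1), hpq (a 1 0) (b 1 0), hpq (a 1 1) (b 1 1)]
  have hDcomb (x y : ℂ) : D (x * z₀ + y * w₀) (x * z₁ + y * w₁) =
      x ^ 2 * D z₀ z₁ + y ^ 2 * D w₀ w₁ := by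
    rw [← hw₀, ← hw₁] at hdiag
    rw [hD, hM]
    dsimp only
    linear_combination (2 * x * y) * hdiag +
      x * y * (a 0 0 * b 1 1 + b 0 0 * a 1 1 - a 0 1 * b 1 0 - b 0 1 * a 1 0) * z₁ *
        (hw₀ : w₀ = -starRingEnd ℂ z₁)
  obtain ⟨c, hc, hopp⟩ := exists_phase_sq_opposite (D z₀ z₁) (D w₀ w₁)
  have hFw : F w₀ w₁ = 1 - F z₀ z₁ := by linarith
  refine pencil_constraints_false (u := F z₀ z₁) (a := ‖D z₀ z₁‖) (b := ‖D w₀ w₁‖) hs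
    (hmem _ _ hz).1 (hFw ▸ (hmem _ _ hw).1) (norm_nonneg _) (hDF _ _) (norm_nonneg _)
    (hFw ▸ hDF _ _) fun t ht0 ht1 => ?_
  have ht1' : 0 ≤ 1 - t := by linarith
  obtain ⟨x, hx⟩ : ∃ x : ℂ, x = (√t : ℝ) := ⟨_, rfl⟩
  obtain ⟨y, hy⟩ : ∃ y : ℂ, y = (√(1 - t) : ℝ) * c := ⟨_, rfl⟩
  have hxn : ‖x‖ ^ 2 = t := by
    rw [hx, Complex.norm_real, Real.norm_eq_abs, sq_abs, Real.sq_sqrt ht0]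
  have hyn : ‖y‖ ^ 2 = 1 - t := by
    rw [hy, norm_mul, hc, mul_one, Complex.norm_real, Real.norm_eq_abs, sq_abs, Real.sq_sqrt ht1']
  have hx2 : x ^ 2 = (t : ℝ) := by rw [hx, ← Complex.ofReal_pow, Real.sq_sqrt ht0]
  have hy2 : y ^ 2 = ((1 - t : ℝ) : ℂ) * c ^ 2 := by
    rw [hy, mul_pow, ← Complex.ofReal_pow, Real.sq_sqrt ht1']
  have hDt : ‖x ^ 2 * D z₀ z₁ + y ^ 2 * D w₀ w₁‖ ^ 2 =
      (‖D z₀ z₁‖ * t - ‖D w₀ w₁‖ * (1 - t)) ^ 2 := by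
    rw [hx2, hy2, mul_assoc, hopp]
  have h1 := (hmem (x * z₀ + y * w₀) (x * z₁ + y * w₁) (by rw [hunit, hxn, hyn]; ring)).2
  -- Changing the sign of `y` preserves the determinant; averaging the two bounds removes the cross
  -- term from `F`.
  have h2 := (hmem (x * z₀ + -y * w₀) (x * z₁ + -y * w₁)
    (by rw [hunit, norm_neg, hxn, hyn]; ring)).2
  rw [hDcomb, hDt] at h1
  rw [hDcomb, neg_sq, hDt] at h2
  have hFadd : F (x * z₀ + y * w₀) (x * z₁ + y * w₁) + F (x * z₀ + -y * w₀) (x * z₁ + -y * w₁) =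
      2 * (F z₀ z₁ * t + (1 - F z₀ z₁) * (1 - t)) := by
    rw [← hFw, hF, hM]
    dsimp only
    have := hnorm (a 0 0) (b 0 0) x y
    have := hnorm (a 0 1) (b 0 1) x y
    have := hnorm (a 1 0) (b 1 0) x y
    have := hnorm (a 1 1) (b 1 1) x y
    rw [hxn, hyn] at *
    linarith
  nlinarith

/-! ### Slicing and base cases -/

namespace TensorSpace

theorem norm_inner_simpleTensor_le {𝕜 : Type*} [RCLike 𝕜] {d : ℕ} {n : Fin d → ℕ}
    (T : TensorSpace 𝕜 n) {x : (i : Fin d) → EuclideanSpace 𝕜 (Fin (n i))} (hx : ∀ i, ‖x i‖ = 1) :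
    ‖inner 𝕜 (simpleTensor x) T‖ ≤ specNorm T :=
  le_csSup ((isCompact_unitSimple 𝕜 n).image (by fun_prop)).bddAbove
    ⟨simpleTensor x, ⟨x, hx, rfl⟩, rfl⟩

theorem inner_simpleTensor {𝕜 : Type*} [RCLike 𝕜] {d : ℕ} {n : Fin d → ℕ}
    (T : TensorSpace 𝕜 n) (x : (i : Fin d) → EuclideanSpace 𝕜 (Fin (n i))) :
    inner 𝕜 (simpleTensor x) T = ∑ k, T k * ∏ i, starRingEnd 𝕜 (x i (k i)) := by
  simp [PiLp.inner_apply, simpleTensor, map_prod]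

theorem exists_norm_eq_one_specNorm_eq_beta (𝕜 : Type*) [RCLike 𝕜] {d : ℕ} {n : Fin d → ℕ}
    (hn : ∀ i, 0 < n i) : ∃ T : TensorSpace 𝕜 n, ‖T‖ = 1 ∧ specNorm T = beta 𝕜 n :=
  (isLeast_beta 𝕜 hn).1

theorem beta_nonneg (𝕜 : Type*) [RCLike 𝕜] {d : ℕ} {n : Fin d → ℕ} (hn : ∀ i, 0 < n i) :
    0 ≤ beta 𝕜 n := by
  obtain ⟨T, -, hT⟩ := exists_norm_eq_one_specNorm_eq_beta 𝕜 hn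
  obtain ⟨X, -, hX⟩ := (isGreatest_specNorm hn T).1
  rw [← hT, ← hX]
  exact norm_nonneg _

theorem exists_norm_mul_beta_le {𝕜 : Type*} [RCLike 𝕜] {d : ℕ} {n : Fin d → ℕ}
    (hn : ∀ i, 0 < n i) (T : TensorSpace 𝕜 n) :
    ∃ x : (i : Fin d) → EuclideanSpace 𝕜 (Fin (n i)), (∀ i, ‖x i‖ = 1) ∧
      ‖T‖ * beta 𝕜 n ≤ ‖inner 𝕜 (simpleTensor x) T‖ := by
  rcases eq_or_ne T 0 with rfl | hT
  · obtain ⟨-, x, hx, -⟩ := unitSimple_nonempty 𝕜 hn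
    exact ⟨x, hx, by simp⟩
  have hpos : 0 < ‖T‖ := norm_pos_iff.2 hT
  obtain ⟨S, hS⟩ : ∃ S, S = ((‖T‖ : 𝕜)⁻¹) • T := ⟨_, rfl⟩
  have hS1 : ‖S‖ = 1 := by
    rw [hS, norm_smul, norm_inv, RCLike.norm_ofReal, abs_norm, inv_mul_cancel₀ hpos.ne']
  obtain ⟨-, ⟨x, hx, rfl⟩, h⟩ := (isGreatest_specNorm hn S).1
  have hle : beta 𝕜 n ≤ specNorm S := (isLeast_beta 𝕜 hn).2 ⟨S, hS1, rfl⟩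
  refine ⟨x, hx, ?_⟩
  rw [← h, hS] at hle
  dsimp only at hle
  rw [inner_smul_right, norm_mul, norm_inv, RCLike.norm_ofReal, abs_norm] at hle
  calc ‖T‖ * beta 𝕜 n ≤ ‖T‖ * (‖T‖⁻¹ * ‖inner 𝕜 (simpleTensor x) T‖) := by gcongr
    _ = _ := by rw [mul_inv_cancel_left₀ hpos.ne']

/-- Summation over the index set of tensors with `d + 1` modes, first mode first. -/
theorem sum_index_cons {M : Type*} [AddCommMonoid M] {n d : ℕ} (f : (Fin (d + 1) → Fin n) → M) :
    ∑ k, f k = ∑ j : Fin n, ∑ k : Fin d → Fin n, f (Fin.cons j k) := by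
  rw [← (Fin.consEquiv fun _ : Fin (d + 1) => Fin n).sum_comp, Fintype.sum_prod_type]
  rfl

theorem beta_div_sqrt_le_beta_succ (𝕜 : Type*) [RCLike 𝕜] {n : ℕ} (d : ℕ) (hn : 0 < n) :
    beta 𝕜 (fun _ : Fin d => n) / √n ≤ beta 𝕜 (fun _ : Fin (d + 1) => n) := by
  obtain ⟨T, hT, hTβ⟩ :=
    exists_norm_eq_one_specNorm_eq_beta 𝕜 (n := fun _ : Fin (d + 1) => n) fun _ => hn
  let S (j : Fin n) : TensorSpace 𝕜 (fun _ : Fin d => n) :=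
    WithLp.toLp 2 fun k => T (Fin.cons (α := fun _ => Fin n) j k)
  have hsum : ∑ j, ‖S j‖ ^ 2 = 1 := by
    have h1 : ‖T‖ ^ 2 = 1 := by rw [hT, one_pow]
    rw [EuclideanSpace.norm_sq_eq, sum_index_cons] at h1
    simpa [S, EuclideanSpace.norm_sq_eq] using h1
  -- Pigeonhole on the slices.
  obtain ⟨j, hj⟩ : ∃ j, (1 : ℝ) / n ≤ ‖S j‖ ^ 2 := by
    by_contra! h
    have : Nonempty (Fin n) := ⟨⟨0, hn⟩⟩
    have := Finset.sum_lt_sum_of_nonempty Finset.univ_nonempty fun j _ => h j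
    rw [hsum, Finset.sum_const, Finset.card_univ, Fintype.card_fin, nsmul_eq_mul,
      mul_one_div_cancel (by positivity)] at this
    exact this.false
  have hj' : 1 / √n ≤ ‖S j‖ := by
    rw [← Real.sqrt_one, ← Real.sqrt_div zero_le_one]
    exact Real.sqrt_le_iff.2 ⟨norm_nonneg _, hj⟩
  obtain ⟨x, hx, hxS⟩ := exists_norm_mul_beta_le (fun _ => hn) (S j)
  let y : Fin (d + 1) → EuclideanSpace 𝕜 (Fin n) := Fin.cons (EuclideanSpace.single j 1) x
  have hy : ∀ i, ‖y i‖ = 1 := Fin.cases (by simp [y]) fun i => by simpa [y] using hx i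
  have hinner : inner 𝕜 (simpleTensor y) T = inner 𝕜 (simpleTensor x) (S j) := by
    rw [inner_simpleTensor, inner_simpleTensor, sum_index_cons, Finset.sum_eq_single j]
    · simp [Fin.prod_univ_succ, y, S]
    · intro i _ hij
      simp [Fin.prod_univ_succ, y, hij]
    · simp
  calc beta 𝕜 (fun _ : Fin d => n) / √n = 1 / √n * beta 𝕜 (fun _ : Fin d => n) := by ring
    _ ≤ ‖S j‖ * beta 𝕜 (fun _ : Fin d => n) :=
      mul_le_mul_of_nonneg_right hj' (beta_nonneg 𝕜 fun _ => hn)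
    _ ≤ ‖inner 𝕜 (simpleTensor y) T‖ := hinner ▸ hxS
    _ ≤ beta 𝕜 (fun _ : Fin (d + 1) => n) := hTβ ▸ norm_inner_simpleTensor_le T hy

theorem beta_mul_rpow_le_beta_add (𝕜 : Type*) [RCLike 𝕜] {n : ℕ} (d m : ℕ) (hn : 0 < n) :
    beta 𝕜 (fun _ : Fin d => n) * (n : ℝ) ^ (-(m : ℝ) / 2) ≤
      beta 𝕜 (fun _ : Fin (d + m) => n) := by
  induction m with
  | zero => simp
  | succ m ih =>
    have hn' : (0 : ℝ) < n := by exact_mod_cast hn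
    refine le_trans (le_of_eq ?_) ((div_le_div_of_nonneg_right ih (Real.sqrt_nonneg n)).trans
      (beta_div_sqrt_le_beta_succ 𝕜 (d + m) hn))
    rw [Real.sqrt_eq_rpow, mul_div_assoc, ← Real.rpow_sub hn']
    congr 2
    push_cast
    ring

theorem one_le_beta_one_mode (𝕜 : Type*) [RCLike 𝕜] {n : ℕ} (hn : 0 < n) :
    1 ≤ beta 𝕜 (fun _ : Fin 1 => n) := by
  obtain ⟨T, hT, hTβ⟩ :=
    exists_norm_eq_one_specNorm_eq_beta 𝕜 (n := fun _ : Fin 1 => n) fun _ => hn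
  let x : Fin 1 → EuclideanSpace 𝕜 (Fin n) := fun _ => WithLp.toLp 2 fun j => T fun _ => j
  have hsum (f : (Fin 1 → Fin n) → ℝ) : ∑ k, f k = ∑ j, f fun _ => j :=
    ((Equiv.funUnique (Fin 1) (Fin n)).symm.sum_comp f).symm
  have hx : ∀ i, ‖x i‖ = 1 := fun i => by
    rw [← hT, EuclideanSpace.norm_eq, EuclideanSpace.norm_eq, hsum]
  have hTx : simpleTensor x = T := by
    refine PiLp.ext fun k => ?_
    simp only [simpleTensor, x, Fin.prod_univ_one]
    exact congrArg T (funext fun i => by rw [Subsingleton.elim i 0])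
  have := norm_inner_simpleTensor_le T hx
  rwa [hTx, inner_self_eq_norm_sq_to_K, hT, hTβ, RCLike.ofReal_one, one_pow, norm_one] at this

theorem norm_inner_simpleTensor_le_specNorm_mul {𝕜 : Type*} [RCLike 𝕜] {d : ℕ} {n : Fin d → ℕ}
    (T : TensorSpace 𝕜 n) (x : (i : Fin d) → EuclideanSpace 𝕜 (Fin (n i))) :
    ‖inner 𝕜 (simpleTensor x) T‖ ≤ specNorm T * ∏ i, ‖x i‖ := by
  by_cases h0 : ∃ i, x i = 0
  · obtain ⟨i, hi⟩ := h0
    have h1 : simpleTensor x = 0 := by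
      ext k
      exact Finset.prod_eq_zero (Finset.mem_univ i) (by simp [hi])
    rw [h1, inner_zero_left, norm_zero, Finset.prod_eq_zero (Finset.mem_univ i) (by simp [hi]),
      mul_zero]
  · push Not at h0
    have hpos (i) : 0 < ‖x i‖ := norm_pos_iff.2 (h0 i)
    obtain ⟨y, hy⟩ : ∃ y : (i : Fin d) → EuclideanSpace 𝕜 (Fin (n i)),
      y = fun i => ((‖x i‖ : 𝕜)⁻¹) • x i := ⟨_, rfl⟩
    have hy1 (i) : ‖y i‖ = 1 := by
      rw [hy, norm_smul, norm_inv, RCLike.norm_ofReal, abs_norm, inv_mul_cancel₀ (hpos i).ne']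
    have hxy : simpleTensor x = ((∏ i, ‖x i‖ : ℝ) : 𝕜) • simpleTensor y := by
      ext k
      simp only [simpleTensor, hy, PiLp.smul_apply, smul_eq_mul, RCLike.ofReal_prod,
        ← Finset.prod_mul_distrib]
      refine Finset.prod_congr rfl fun i _ => ?_
      rw [mul_inv_cancel_left₀ (RCLike.ofReal_ne_zero.2 (hpos i).ne')]
    have h1 : 0 ≤ ∏ i, ‖x i‖ := Finset.prod_nonneg fun i _ => norm_nonneg _
    rw [hxy, inner_smul_left, norm_mul, RCLike.norm_conj, RCLike.norm_ofReal, abs_of_nonneg h1,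
      mul_comm]
    exact mul_le_mul_of_nonneg_right (norm_inner_simpleTensor_le T hy1) h1

theorem two_thirds_le_beta_three_qubits : 2 / 3 ≤ beta ℂ (fun _ : Fin 3 => 2) := by
  obtain ⟨T, hT, hTβ⟩ :=
    exists_norm_eq_one_specNorm_eq_beta ℂ (n := fun _ : Fin 3 => 2) fun _ => two_pos
  have hsum {M : Type} [AddCommMonoid M] (f : (Fin 3 → Fin 2) → M) :
      ∑ k, f k = ∑ i, ∑ j, ∑ l, f ![i, j, l] := by
    rw [sum_index_cons]
    refine Finset.sum_congr rfl fun i _ => ?_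
    rw [sum_index_cons]
    refine Finset.sum_congr rfl fun j _ => ?_
    rw [sum_index_cons]
    refine Finset.sum_congr rfl fun l _ => ?_
    rw [Fintype.sum_unique]
    congr 1
  have hβ := beta_nonneg ℂ (n := fun _ : Fin 3 => 2) fun _ => two_pos
  have key : 4 / 9 ≤ beta ℂ (fun _ : Fin 3 => 2) ^ 2 := by
    refine four_ninths_le_of_trilinear_bound (a := fun j l => T ![0, j, l])
      (b := fun j l => T ![1, j, l]) ?_ fun v₀ v₁ x₀ x₁ y₀ y₁ => ?_
    · have h1 : ‖T‖ ^ 2 = 1 := by rw [hT, one_pow]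
      rw [EuclideanSpace.norm_sq_eq, hsum] at h1
      simp only [Fin.sum_univ_two] at h1
      linarith
    -- The conjugates cancel those in the inner product, leaving a trilinear form.
    · let x : Fin 3 → EuclideanSpace ℂ (Fin 2) :=
        ![WithLp.toLp 2 ![starRingEnd ℂ v₀, starRingEnd ℂ v₁],
          WithLp.toLp 2 ![starRingEnd ℂ x₀, starRingEnd ℂ x₁],
          WithLp.toLp 2 ![starRingEnd ℂ y₀, starRingEnd ℂ y₁]]
      have h1 := pow_le_pow_left₀ (norm_nonneg _)
        (norm_inner_simpleTensor_le_specNorm_mul T x) 2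
      rw [hTβ, inner_simpleTensor, hsum, mul_pow] at h1
      simp [Fin.prod_univ_three, x, mul_pow, EuclideanSpace.norm_sq_eq] at h1
      refine (le_of_eq ?_).trans (h1.trans_eq (by simp only [mul_assoc]))
      congr 2
      ring
  nlinarith

end TensorSpace

theorem mainTheorem11 :
    (∀ (𝕜 : Type*) [RCLike 𝕜] (n d : ℕ), 1 ≤ n → 2 ≤ d →
      TensorSpace.beta 𝕜 (fun _ : Fin (d + 1) => n) ≥
        TensorSpace.beta 𝕜 (fun _ : Fin d => n) / Real.sqrt n) ∧
    (∀ n d : ℕ, 1 ≤ n → 2 ≤ d →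
      TensorSpace.beta ℝ (fun _ : Fin d => n) ≥ (n : ℝ) ^ ((1 - (d : ℝ)) / 2)) ∧
    (∀ d : ℕ, 3 ≤ d →
      TensorSpace.beta ℂ (fun _ : Fin d => 2) ≥ (2 / 3 : ℝ) * (2 : ℝ) ^ (-((d : ℝ) - 3) / 2)) := by
  refine ⟨fun 𝕜 _ n d hn _ => TensorSpace.beta_div_sqrt_le_beta_succ 𝕜 d hn,
    fun n d hn hd => ?_, fun d hd => ?_⟩
  -- The induction starts at one mode, which accounts for the exponent `(1 - d) / 2`.
  · obtain ⟨m, rfl⟩ : ∃ m, d = 1 + m := Nat.exists_eq_add_of_le (by omega)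
    have h1 := TensorSpace.beta_mul_rpow_le_beta_add ℝ 1 m hn
    have h2 := TensorSpace.one_le_beta_one_mode ℝ hn
    have h3 : (0 : ℝ) ≤ (n : ℝ) ^ (-(m : ℝ) / 2) := by positivity
    rw [show (1 - ((1 + m : ℕ) : ℝ)) / 2 = -(m : ℝ) / 2 by push_cast; ring]
    exact (le_mul_of_one_le_left h3 h2).trans h1
  · obtain ⟨m, rfl⟩ := Nat.exists_eq_add_of_le hd
    have h1 := TensorSpace.beta_mul_rpow_le_beta_add ℂ 3 m two_pos
    have h3 : (0 : ℝ) ≤ (2 : ℝ) ^ (-(m : ℝ) / 2) := by positivity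
    rw [show -(((3 + m : ℕ) : ℝ) - 3) / 2 = -(m : ℝ) / 2 by push_cast; ring]
    exact (mul_le_mul_of_nonneg_right TensorSpace.two_thirds_le_beta_three_qubits h3).trans
      (by exact_mod_cast h1)
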